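/- Let $n,N\in\mathbb N$ and let $f_1,\dots,f_N:\mathbb R^n\to\mathbb R$ be convex and twice continuously differentiable, such that $\sum_{i=1}^N f_i$ is strictly convex and attains its minimum at some point of $\mathbb R^n$. Let $\mathcal G$ be a connected undirected graph on the vertices $1,\dots,N$ with $M$ edges. Orient the edges arbitrarily, let $D\in\mathbb R^{N\times M}$ be the resulting incidence matrix ($d_{ik}=1$ if edge $k$ points to node $i$, $d_{ik}=-1$ if edge $k$ originates at node $i$, and $d_{ik}=0$ otherwise), let $L=DD^T$ be the graph Laplacian, and put $\mathbf D=I_n\otimes D$, $\mathbf L=I_n\otimes L$. Agent $i$ holds a vector $x_i\in\mathbb R^n$; write $z=(z_1,\dots,z_n)\in\mathbb R^{Nn}$ with $z_j=(x_{1j},\dots,x_{Nj})$, and $f(z)=\sum_{i=1}^N f_i(x_i)$. For constants $k_G,k_P,k_I'>0$ consider, for $z\in\mathbb R^{Nn}$ and $\mu\in\mathbb R^{Mn}$, the PI dynamics $$\dot z=-k_G\nabla f(z)-k_P\mathbf L z-k_I'\mathbf D\mu,\qquad \dot\mu=k_I'\mathbf D^Tz .$$ Then $(\dot z,\dot\mu)=(0,0)$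 is globally asymptotically stable and the agents reach consensus. Precisely: 1. The set $\mathcal S$ of points $(z,\mu)$ at which $(\dot z,\dot\mu)=(0,0)$ is nonempty, and from every initial condition there is a solution defined on $[0,\infty)$. 2. The velocity $(\dot z,\dot\mu)=(0,0)$ is globally asymptotically stable: for every $\varepsilon>0$ there is $\delta>0$ such that every solution on $[0,\infty)$ with $\|(\dot z(0),\dot\mu(0))\|<\delta$ satisfies $\|(\dot z(t),\dot\mu(t))\|<\varepsilon$ for all $t\ge 0$, and $(\dot z(t),\dot\mu(t))\to(0,0)$ as $t\to\infty$ along every solution on $[0,\infty)$. 3. The set $\mathcal S$ is globally asymptotically stable: for every $\varepsilon>0$ there is $\delta>0$ such that every solution on $[0,\infty)$ which starts at distance less than $\delta$ from $\mathcal S$ stays at distance less than $\varepsilon$ from $\mathcal S$ for all $t\ge0$, and the distance to $\mathcal S$ tends to $0$ along every solution on $[0,\infty)$. 4. Every solution on $[0,\infty)$ converges to a point of $\mathcal S$ as $t\to\infty$, and there is $c\in\mathbb R^n$ (depending on the solution) such that $x_i(t)\to c$ for every $i\in\{1,\dots,N\}$. -/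

import Mathlib

open scoped Kronecker Topology

namespace PIOpt

/-- An assignment of an orientation to every edge of an undirected graph: the edge `e` originates
at `tail e` and points to `head e`. -/
structure EdgeOrientation {N : ℕ} (G : SimpleGraph (Fin N)) where
  tail : G.edgeSet → Fin N
  head : G.edgeSet → Fin N
  mk_eq : ∀ e : G.edgeSet, s(tail e, head e) = (e : Sym2 (Fin N))

/-- The space of aggregate states `z = (z₁, …, zₙ)`, where `z_j = (x_{1j}, …, x_{Nj})`: the
coordinate `z (j, i)` is the `j`-th entry of the vector `x_i` held by agent `i`. -/
abbrev StateSpace (n N : ℕ) : Type := EuclideanSpace ℝ (Fin n × Fin N)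

/-- The space of aggregate multipliers `μ`: one vector of `ℝⁿ` for every edge of the graph, ordered
in the same fashion as the aggregate state. -/
abbrev DualSpace (n : ℕ) {N : ℕ} (G : SimpleGraph (Fin N)) : Type :=
  EuclideanSpace ℝ (Fin n × G.edgeSet)

/-- The vector `x_i ∈ ℝⁿ` held by agent `i` in the aggregate state `z`. -/
def agentState {n N : ℕ} (z : StateSpace n N) (i : Fin N) : EuclideanSpace ℝ (Fin n) :=
  WithLp.toLp 2 fun j => z (j, i)

/-- The aggregate cost `f(z) = ∑ᵢ fᵢ(xᵢ)`. -/
def aggregateCost {n N : ℕ} (f : Fin N → EuclideanSpace ℝ (Fin n) → ℝ) (z : StateSpace n N) : ℝ :=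
  ∑ i, f i (agentState z i)

section Matrices

variable {N : ℕ} {G : SimpleGraph (Fin N)}

/-- The incidence matrix `D` of the oriented graph. -/
def incidence (o : EdgeOrientation G) : Matrix (Fin N) G.edgeSet ℝ :=
  Matrix.of fun i e => if i = o.head e then 1 else if i = o.tail e then -1 else 0

/-- The aggregate incidence matrix `𝐃 = Iₙ ⊗ D`. -/
def aggIncidence (n : ℕ) (o : EdgeOrientation G) :
    Matrix (Fin n × Fin N) (Fin n × G.edgeSet) ℝ :=
  (1 : Matrix (Fin n) (Fin n) ℝ) ⊗ₖ incidence o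

/-- The graph Laplacian `L = D Dᵀ`. -/
def laplacian [DecidableRel G.Adj] (o : EdgeOrientation G) : Matrix (Fin N) (Fin N) ℝ :=
  incidence o * (incidence o).transpose

/-- The aggregate Laplacian `𝐋 = Iₙ ⊗ L`. -/
def aggLaplacian [DecidableRel G.Adj] (n : ℕ) (o : EdgeOrientation G) :
    Matrix (Fin n × Fin N) (Fin n × Fin N) ℝ :=
  (1 : Matrix (Fin n) (Fin n) ℝ) ⊗ₖ laplacian o

/-- The vector field of the PI dynamics on pairs `(z, μ)`:
`ż = -k_G ∇f(z) - k_P 𝐋 z - k_I' 𝐃 μ` and `μ̇ = k_I' 𝐃ᵀ z`. -/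
noncomputable def piField [DecidableRel G.Adj] {n : ℕ} (f : Fin N → EuclideanSpace ℝ (Fin n) → ℝ)
    (o : EdgeOrientation G) (kG kP kI : ℝ) (p : StateSpace n N × DualSpace n G) :
    StateSpace n N × DualSpace n G :=
  (-(kG • gradient (aggregateCost f) p.1) - kP • Matrix.toEuclideanLin (aggLaplacian n o) p.1
      - kI • Matrix.toEuclideanLin (aggIncidence n o) p.2,
    kI • Matrix.toEuclideanLin (aggIncidence n o).transpose p.1)

end Matrices

section Stability

variable {E : Type*} [NormedAddCommGroup E] [NormedSpace ℝ E]

/-- `x` solves the autonomous equation `ẋ = F(x)` on `[0, ∞)` (with the one-sided derivative at the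
initial time). -/
def IsSolution (F : E → E) (x : ℝ → E) : Prop :=
  IsIntegralCurveOn x (fun _ => F) (Set.Ici 0)

/-- The set of equilibria of `ẋ = F(x)`. -/
def equilibria (F : E → E) : Set E := {p | F p = 0}

/-- Global asymptotic stability of a set `S` for `ẋ = F(x)`: solutions exist for all positive times
from every initial condition, `S` is Lyapunov stable, and `S` attracts every solution. -/
structure GASSet (F : E → E) (S : Set E) : Prop where
  nonempty : S.Nonempty
  complete : ∀ x₀ : E, ∃ x : ℝ → E, IsSolution F x ∧ x 0 = x₀
  stable : ∀ ε > 0, ∃ δ > 0, ∀ x : ℝ → E, IsSolution F x → Metric.infDist (x 0) S < δ →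
    ∀ t ≥ 0, Metric.infDist (x t) S < ε
  attractive : ∀ x : ℝ → E, IsSolution F x →
    Filter.Tendsto (fun t => Metric.infDist (x t) S) Filter.atTop (𝓝 0)

/-- Global asymptotic stability of the velocity `ẋ = 0`: the same notion, read on the velocity
`ẋ(t) = F(x(t))` of the solutions instead of on their position. -/
structure GASVelocity (F : E → E) : Prop where
  attained : ∃ p, F p = 0
  complete : ∀ x₀ : E, ∃ x : ℝ → E, IsSolution F x ∧ x 0 = x₀
  stable : ∀ ε > 0, ∃ δ > 0, ∀ x : ℝ → E, IsSolution F x → ‖F (x 0)‖ < δ →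
    ∀ t ≥ 0, ‖F (x t)‖ < ε
  attractive : ∀ x : ℝ → E, IsSolution F x →
    Filter.Tendsto (fun t => F (x t)) Filter.atTop (𝓝 0)

end Stability

end PIOpt

/-!
The right-hand side `F` of the PI dynamics is minus a monotone map. For two points `p = (z, μ)` and
`q = (z', μ')`, the terms `-k_I' 𝐃 μ` and `k_I' 𝐃ᵀ z` cancel in the inner product and
`⟪F p - F q, p - q⟫ = -k_G ⟪∇f(z) - ∇f(z'), z - z'⟫ - k_P ‖𝐃ᵀ(z - z')‖² ≤ 0`
(`inner_piField_sub`). Hence the Euclidean distance of two solutions never increases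
(`Dissipative.antitoneOn_norm_sub`), and nearly everything follows from this one fact.

* Comparing a solution with an equilibrium bounds it, which gives existence for all times
  (`Dissipative.exists_isSolution`) and stability of the set of equilibria.
* Comparing a solution with its own time shifts shows that its speed never increases
  (`Dissipative.norm_velocity_le`), which is stability of the zero velocity.
* Let `q` be a limit point of a solution `x` and let `p` be an equilibrium. Time shifts of `x`
  converge to the solution from `q`, along which the distance to `p` is therefore constant. If this
  forces `q` to be an equilibrium, then the distance from `x` to `q` decreases, and `x` converges to
  `q` (`Dissipative.exists_tendsto`).

It remains to see that stationary distance forces equilibrium. Let `x*` minimize `∑ᵢ fᵢ`. The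
gradient of the aggregate cost at `𝟏 ⊗ x*` is orthogonal to all consensus states, that is, to the
kernel of `𝐃ᵀ` (the graph is connected), so it lies in the range of `𝐃`. This yields an equilibrium
`(𝟏 ⊗ x*, μ*)`. Where the rate at which the distance to it changes vanishes, `𝐃ᵀ z = 0`, so
`z = 𝟏 ⊗ x`, and then strict convexity of `∑ᵢ fᵢ` gives `x = x*`
(`fst_eq_consensus_of_inner_eq_zero`). Along a solution with stationary distance `z` is thus
constant, so that `ż = 0` and `μ̇ = k_I' 𝐃ᵀ z = 0`.
-/

namespace PIOpt

/-! ### Solutions of autonomous equations -/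

section Solutions

variable {E : Type*} [NormedAddCommGroup E] [NormedSpace ℝ E] {F : E → E} {x : ℝ → E}

lemma IsSolution.comp_const_add (hx : IsSolution F x) {s : ℝ} (hs : 0 ≤ s) :
    IsSolution F (fun t => x (s + t)) := by
  intro t ht
  have ht' : s + t ∈ Set.Ici (0 : ℝ) := add_nonneg hs ht
  have h := (hx _ ht').scomp t (h := fun t => s + t) (s := Set.Ici 0)
    ((hasDerivWithinAt_id t _).const_add s) (fun r hr => add_nonneg hs hr)
  simpa [Function.comp_def] using h

lemma isSolution_const {p : E} (hp : F p = 0) : IsSolution F (fun _ => p) := by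
  intro t _
  simpa [hp] using hasDerivWithinAt_const t (Set.Ici (0 : ℝ)) p

/-- A bounded Lipschitz vector field has a solution from every point: boundedness makes the
Picard–Lindelöf theorem applicable on `[0, m]` for every `m`, and by uniqueness these solutions
extend one another. -/
theorem exists_isSolution_of_lipschitz_of_bounded [CompleteSpace E] {K : NNReal}
    (hK : LipschitzWith K F) {C : ℝ} (hC : ∀ p, ‖F p‖ ≤ C) (x₀ : E) :
    ∃ x : ℝ → E, IsSolution F x ∧ x 0 = x₀ := by
  have hC0 : 0 ≤ C := (norm_nonneg _).trans (hC x₀)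
  have key : ∀ m : ℕ, ∃ α : ℝ → E, α 0 = x₀ ∧
      ∀ t ∈ Set.Icc (0 : ℝ) m, HasDerivWithinAt α (F (α t)) (Set.Icc 0 (m : ℝ)) t := by
    intro m
    have hPL : IsPicardLindelof (fun _ : ℝ => F) (tmin := 0) (tmax := m)
        ⟨0, le_rfl, Nat.cast_nonneg m⟩ x₀ (C.toNNReal * m) 0 C.toNNReal K := by
      refine ⟨fun t _ => hK.lipschitzOnWith, fun p _ => continuousOn_const, fun t _ p _ => ?_, ?_⟩
      · simpa [Real.coe_toNNReal C hC0] using hC p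
      · simp
    exact hPL.exists_eq_forall_mem_Icc_hasDerivWithinAt₀
  choose α hα0 hα using key
  have agree : ∀ m k : ℕ, m ≤ k → Set.EqOn (α m) (α k) (Set.Icc 0 (m : ℝ)) := by
    intro m k hmk
    have hmk' : (m : ℝ) ≤ k := by exact_mod_cast hmk
    have hder : ∀ l : ℕ, m ≤ l → ∀ t ∈ Set.Ico (0 : ℝ) m,
        HasDerivWithinAt (α l) (F (α l t)) (Set.Ici t) t := by
      intro l hl t ht
      have hl' : (m : ℝ) ≤ l := by exact_mod_cast hl
      exact (hα l t ⟨ht.1, (ht.2.le.trans hl')⟩).mono_of_mem_nhdsWithin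
        (Filter.mem_of_superset (Icc_mem_nhdsGE (ht.2.trans_le hl'))
          (Set.Icc_subset_Icc_left ht.1))
    have hcont : ∀ l : ℕ, m ≤ l → ContinuousOn (α l) (Set.Icc 0 (m : ℝ)) := by
      intro l hl t ht
      have hl' : (m : ℝ) ≤ l := by exact_mod_cast hl
      exact ((hα l t ⟨ht.1, ht.2.trans hl'⟩).continuousWithinAt).mono
        (Set.Icc_subset_Icc_right hl')
    exact ODE_solution_unique_of_mem_Icc_right (v := fun _ => F) (s := fun _ => Set.univ)
      (fun t _ => hK.lipschitzOnWith) (hcont m le_rfl) (hder m le_rfl) (fun _ _ => Set.mem_univ _)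
      (hcont k hmk) (hder k hmk) (fun _ _ => Set.mem_univ _) (by rw [hα0, hα0])
  refine ⟨fun t => α (⌊t⌋₊ + 1) t, fun t ht => ?_, by simp [hα0]⟩
  have ht0 : (0 : ℝ) ≤ t := ht
  set m : ℕ := ⌊t⌋₊ + 1 with hm
  have htm : t < m := by simpa [hm] using Nat.lt_floor_add_one t
  have heq : ∀ s ∈ Set.Icc (0 : ℝ) m, α (⌊s⌋₊ + 1) s = α m s := by
    intro s hs
    rcases le_total (⌊s⌋₊ + 1) m with h | h
    · exact agree _ _ h ⟨hs.1, by simpa using (Nat.lt_floor_add_one s).le⟩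
    · exact (agree _ _ h hs).symm
  refine ((hα m t ⟨ht0, htm.le⟩).congr heq (heq t ⟨ht0, htm.le⟩)).mono_of_mem_nhdsWithin ?_
  rw [← Set.Ici_inter_Iic]
  exact Filter.inter_mem self_mem_nhdsWithin (mem_nhdsWithin_of_mem_nhds (Iic_mem_nhds htm))

end Solutions

/-! ### Dissipative vector fields -/

section Dissipative

variable {E H : Type*} [NormedAddCommGroup E] [NormedSpace ℝ E]
  [NormedAddCommGroup H] [InnerProductSpace ℝ H]

/-- `F` is dissipative for the inner product that the isomorphism `T` pulls back to `E`.
The isomorphism is there because the norm of `E` itself (such as the supremum norm of a product)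
need not come from an inner product. -/
def Dissipative (T : E ≃L[ℝ] H) (F : E → E) : Prop :=
  ∀ p q : E, inner ℝ (T (F p) - T (F q)) (T p - T q) ≤ 0

variable {T : E ≃L[ℝ] H} {F : E → E} {x y : ℝ → E}

lemma IsSolution.hasDerivWithinAt_norm_sub_sq (T : E ≃L[ℝ] H) (hx : IsSolution F x)
    (hy : IsSolution F y) {t : ℝ} (ht : 0 ≤ t) :
    HasDerivWithinAt (fun t => ‖T (x t) - T (y t)‖ ^ 2)
      (2 * inner ℝ (T (x t) - T (y t)) (T (F (x t)) - T (F (y t)))) (Set.Ici 0) t := by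
  have h1 := T.hasFDerivAt.comp_hasDerivWithinAt t (hx t ht)
  have h2 := T.hasFDerivAt.comp_hasDerivWithinAt t (hy t ht)
  exact (h1.sub h2).norm_sq

/-- Constants comparing the norm of `E` with the pulled back Hilbert norm. -/
lemma exists_norm_bounds (T : E ≃L[ℝ] H) : ∃ c C : ℝ, 0 < c ∧ 0 < C ∧
    (∀ v : E, ‖v‖ ≤ c * ‖T v‖) ∧ ∀ v : E, ‖T v‖ ≤ C * ‖v‖ := by
  refine ⟨‖(T.symm : H →L[ℝ] E)‖ + 1, ‖(T : E →L[ℝ] H)‖ + 1, by positivity, by positivity,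
    fun v => ?_, fun v => ?_⟩
  · have h := (T.symm : H →L[ℝ] E).le_opNorm (T v)
    simp only [ContinuousLinearEquiv.coe_coe, ContinuousLinearEquiv.symm_apply_apply] at h
    nlinarith [norm_nonneg (T v)]
  · have h := (T : E →L[ℝ] H).le_opNorm v
    simp only [ContinuousLinearEquiv.coe_coe] at h
    nlinarith [norm_nonneg v]

/-- The flow of a dissipative vector field is nonexpansive. -/
theorem Dissipative.antitoneOn_norm_sub (hF : Dissipative T F) (hx : IsSolution F x)
    (hy : IsSolution F y) : AntitoneOn (fun t => ‖T (x t) - T (y t)‖) (Set.Ici 0) := by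
  have h : AntitoneOn (fun t => ‖T (x t) - T (y t)‖ ^ 2) (Set.Ici 0) := by
    refine antitoneOn_of_hasDerivWithinAt_nonpos (convex_Ici 0)
      (fun t ht => (hx.hasDerivWithinAt_norm_sub_sq T hy ht).continuousWithinAt)
      (fun t ht => (hx.hasDerivWithinAt_norm_sub_sq T hy (interior_subset ht)).mono interior_subset)
      fun t ht => ?_
    rw [real_inner_comm]
    linarith [hF (x t) (y t)]
  intro s hs t ht hst
  exact le_of_sq_le_sq (h hs ht hst) (norm_nonneg _)

/-- The speed of a solution never exceeds its initial value: the difference quotients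
`h⁻¹ (x (t + h) - x t)` compare two solutions, hence their norms are largest at `t = 0`. -/
theorem Dissipative.norm_velocity_le (hF : Dissipative T F) (hx : IsSolution F x) {t : ℝ}
    (ht : 0 ≤ t) : ‖T (F (x t))‖ ≤ ‖T (F (x 0))‖ := by
  have lim : ∀ s : ℝ, 0 ≤ s → Filter.Tendsto (fun h : ℝ => ‖T (h⁻¹ • (x (s + h) - x s))‖)
      (𝓝[>] 0) (𝓝 ‖T (F (x s))‖) := by
    intro s hs
    have h := (hx.comp_const_add hs) 0 Set.self_mem_Ici
    rw [hasDerivWithinAt_iff_tendsto_slope, Set.Ici_sdiff_left] at h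
    have h' := (T.continuous.tendsto _).comp h
    simpa [Function.comp_def, slope_def_module] using h'.norm
  refine le_of_tendsto_of_tendsto (lim t ht) (lim 0 le_rfl) ?_
  filter_upwards [self_mem_nhdsWithin] with h hh
  have hh' : (0 : ℝ) < h := hh
  have := hF.antitoneOn_norm_sub (hx.comp_const_add hh'.le) hx Set.self_mem_Ici ht ht
  simp only [map_smul, map_sub, norm_smul, zero_add]
  rw [add_comm t h]
  simp only [add_zero] at this
  exact mul_le_mul_of_nonneg_left this (norm_nonneg _)

/-- A continuously differentiable dissipative vector field with an equilibrium has a solution on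
`[0, ∞)` from every point. Cutting the field off far away from the equilibrium makes it bounded and
Lipschitz, and does not affect the solution, whose distance to the equilibrium never increases. -/
theorem Dissipative.exists_isSolution [FiniteDimensional ℝ E] (hF : Dissipative T F)
    (hsmooth : ContDiff ℝ 1 F) {p : E} (hp : F p = 0) (x₀ : E) :
    ∃ x : ℝ → E, IsSolution F x ∧ x 0 = x₀ := by
  have : CompleteSpace E := FiniteDimensional.complete ℝ E
  obtain ⟨c, -, hc0, -, hc, -⟩ := exists_norm_bounds T
  set r : ℝ := c * ‖T x₀ - T p‖ + 1 with hr
  have hr0 : 0 < r := by positivity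
  let φ : ContDiffBump p := ⟨r, r + 1, hr0, by linarith⟩
  set G : E → E := fun q => φ q • F q with hG
  have hGc : ContDiff ℝ 1 G := φ.contDiff.smul hsmooth
  have hGs : HasCompactSupport G := φ.hasCompactSupport.smul_right
  obtain ⟨K, hK⟩ : ∃ K, LipschitzWith K G := hGc.lipschitzWith_of_hasCompactSupport hGs one_ne_zero
  obtain ⟨C, hC⟩ := hGc.continuous.bounded_above_of_compact_support hGs
  obtain ⟨x, hx, hx0⟩ := exists_isSolution_of_lipschitz_of_bounded hK hC x₀
  have hGp : G p = 0 := by simp [hG, hp]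
  have hanti : AntitoneOn (fun t => ‖T (x t) - T p‖ ^ 2) (Set.Ici 0) := by
    have hd := fun t (ht : 0 ≤ t) =>
      hx.hasDerivWithinAt_norm_sub_sq T (isSolution_const hGp) ht
    refine antitoneOn_of_hasDerivWithinAt_nonpos (convex_Ici 0)
      (fun t ht => (hd t ht).continuousWithinAt)
      (fun t ht => (hd t (interior_subset ht)).mono interior_subset) fun t _ => ?_
    have h1 := hF (x t) p
    rw [hp, map_zero, sub_zero] at h1
    rw [hGp, map_zero, sub_zero, hG, map_smul, inner_smul_right, real_inner_comm]
    have := φ.nonneg' (x t)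
    nlinarith
  refine ⟨x, fun t ht => ?_, hx0⟩
  have hle : ‖T (x t) - T p‖ ≤ ‖T x₀ - T p‖ := by
    rw [← hx0]
    exact le_of_sq_le_sq (hanti Set.self_mem_Ici ht ht) (norm_nonneg _)
  have hball : x t ∈ Metric.closedBall p φ.rIn := by
    rw [mem_closedBall_iff_norm]
    have h1 := hc (x t - p)
    rw [map_sub] at h1
    have h2 : ‖x t - p‖ ≤ r := by nlinarith
    exact h2
  have h := hx t ht
  have hGx : G (x t) = F (x t) := by
    simp only [hG]
    rw [φ.one_of_mem_closedBall hball, one_smul]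
  simp only [hGx] at h
  exact h

/-- An invariance principle: a solution of a dissipative system converges to an equilibrium,
provided a solution along which the distance to the equilibrium `p` is stationary starts at an
equilibrium. The solution `y` from a limit point `q` of a solution `x` is the limit of time shifts
of `x` because the flow is nonexpansive; hence its distance to `p` is constant and `q` is an
equilibrium. The distance of `x` to `q` decreases and comes arbitrarily close to zero. -/
theorem Dissipative.exists_tendsto [FiniteDimensional ℝ E] (hF : Dissipative T F)
    (hsmooth : ContDiff ℝ 1 F) {p : E} (hp : F p = 0)
    (hinv : ∀ y : ℝ → E, IsSolution F y →
      (∀ t ≥ 0, inner ℝ (T (F (y t))) (T (y t) - T p) = 0) → F (y 0) = 0)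
    (hx : IsSolution F x) : ∃ q, F q = 0 ∧ Filter.Tendsto x Filter.atTop (𝓝 q) := by
  have : FiniteDimensional ℝ H := T.toLinearEquiv.finiteDimensional
  have hmono := hF.antitoneOn_norm_sub hx (isSolution_const hp)
  -- the distance to `p` converges along `x`, to some `d`
  obtain ⟨d, hd⟩ : ∃ d, Filter.Tendsto (fun t => ‖T (x t) - T p‖) Filter.atTop (𝓝 d) := by
    have hanti : Antitone (fun t : ℝ => ‖T (x (max t 0)) - T p‖) := fun s t hst =>
      hmono (Set.mem_Ici.2 (le_max_right s 0)) (Set.mem_Ici.2 (le_max_right t 0))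
        (max_le_max_right 0 hst)
    have hbdd : BddBelow (Set.range fun t : ℝ => ‖T (x (max t 0)) - T p‖) :=
      ⟨0, by rintro _ ⟨t, rfl⟩; exact norm_nonneg _⟩
    refine ⟨_, (tendsto_atTop_ciInf hanti hbdd).congr' ?_⟩
    filter_upwards [Filter.eventually_ge_atTop 0] with t ht
    rw [max_eq_left ht]
  -- a limit point `q` of `x`, approached along the integer times `φ k`
  obtain ⟨h, -, φ, hφ, hlim⟩ := (isCompact_closedBall (T p) ‖T (x 0) - T p‖).tendsto_subseq
    (x := fun k : ℕ => T (x k)) fun k => by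
      rw [mem_closedBall_iff_norm]
      exact hmono Set.self_mem_Ici (Set.mem_Ici.2 (Nat.cast_nonneg k)) (Nat.cast_nonneg k)
  obtain ⟨q, rfl⟩ := T.surjective h
  have htime : Filter.Tendsto (fun k => (φ k : ℝ)) Filter.atTop Filter.atTop :=
    tendsto_natCast_atTop_atTop.comp hφ.tendsto_atTop
  obtain ⟨y, hy, hy0⟩ := hF.exists_isSolution hsmooth hp q
  have hdist0 : Filter.Tendsto (fun k => ‖T (x (φ k)) - T q‖) Filter.atTop (𝓝 0) := by
    simpa using (hlim.sub_const (T q)).norm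
  have hconst : ∀ s ≥ 0, ‖T (y s) - T p‖ = d := by
    intro s hs
    have h1 : Filter.Tendsto (fun k => T (x (φ k + s)) - T (y s)) Filter.atTop (𝓝 0) := by
      refine squeeze_zero_norm (fun k => ?_) hdist0
      have := hF.antitoneOn_norm_sub (hx.comp_const_add (Nat.cast_nonneg (φ k))) hy
        Set.self_mem_Ici hs hs
      simpa [hy0] using this
    have h2 : Filter.Tendsto (fun k => ‖T (x (φ k + s)) - T p‖) Filter.atTop
        (𝓝 ‖T (y s) - T p‖) := by
      simpa using (h1.add_const (T (y s) - T p)).norm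
    exact tendsto_nhds_unique h2 (hd.comp (Filter.tendsto_atTop_add_const_right _ s htime))
  have hFq : F q = 0 := by
    rw [← hy0]
    refine hinv y hy fun t ht => ?_
    have h1 := hy.hasDerivWithinAt_norm_sub_sq T (isSolution_const hp) ht
    have h2 : HasDerivWithinAt (fun t => ‖T (y t) - T p‖ ^ 2) 0 (Set.Ici 0) t :=
      (hasDerivWithinAt_const t _ (d ^ 2)).congr (fun s hs => by rw [hconst s hs])
        (by rw [hconst t ht])
    have h3 := (uniqueDiffOn_Ici (0 : ℝ) t ht).eq_deriv _ h1 h2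
    rw [hp, map_zero, sub_zero, real_inner_comm] at h3
    linarith
  refine ⟨q, hFq, ?_⟩
  have hmonoq := hF.antitoneOn_norm_sub hx (isSolution_const hFq)
  have hT : Filter.Tendsto (fun t => T (x t)) Filter.atTop (𝓝 (T q)) := by
    rw [Metric.tendsto_atTop]
    intro ε hε
    obtain ⟨k, hk⟩ := (hdist0.eventually_lt_const hε).exists
    refine ⟨φ k, fun t ht => ?_⟩
    rw [dist_eq_norm]
    have hφ0 : (0 : ℝ) ≤ φ k := Nat.cast_nonneg _
    exact (hmonoq (Set.mem_Ici.2 hφ0) (Set.mem_Ici.2 (hφ0.trans ht)) ht).trans_lt hk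
  simpa [Function.comp_def] using (T.symm.continuous.tendsto _).comp hT

theorem Dissipative.gasVelocity [FiniteDimensional ℝ E] (hF : Dissipative T F)
    (hsmooth : ContDiff ℝ 1 F) {p : E} (hp : F p = 0)
    (hconv : ∀ x, IsSolution F x → ∃ q, F q = 0 ∧ Filter.Tendsto x Filter.atTop (𝓝 q)) :
    GASVelocity F where
  attained := ⟨p, hp⟩
  complete := hF.exists_isSolution hsmooth hp
  stable := by
    obtain ⟨c, C, hc, hC, h1, h2⟩ := exists_norm_bounds T
    intro ε hε
    refine ⟨ε / (c * C), by positivity, fun x hx hx0 t ht => ?_⟩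
    calc ‖F (x t)‖ ≤ c * ‖T (F (x t))‖ := h1 _
      _ ≤ c * ‖T (F (x 0))‖ := by gcongr; exact hF.norm_velocity_le hx ht
      _ ≤ c * (C * ‖F (x 0)‖) := by gcongr; exact h2 _
      _ = (c * C) * ‖F (x 0)‖ := by ring
      _ < ε := by rwa [lt_div_iff₀' (by positivity)] at hx0
  attractive := by
    intro x hx
    obtain ⟨q, hq, hlim⟩ := hconv x hx
    simpa [Function.comp_def, hq] using (hsmooth.continuous.tendsto q).comp hlim

theorem Dissipative.gasSet_equilibria [FiniteDimensional ℝ E] (hF : Dissipative T F)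
    (hsmooth : ContDiff ℝ 1 F) {p : E} (hp : F p = 0)
    (hconv : ∀ x, IsSolution F x → ∃ q, F q = 0 ∧ Filter.Tendsto x Filter.atTop (𝓝 q)) :
    GASSet F (equilibria F) where
  nonempty := ⟨p, hp⟩
  complete := hF.exists_isSolution hsmooth hp
  stable := by
    obtain ⟨c, C, hc, hC, h1, h2⟩ := exists_norm_bounds T
    intro ε hε
    refine ⟨ε / (c * C), by positivity, fun x hx hx0 t ht => ?_⟩
    obtain ⟨q, hq, hq0⟩ := (Metric.infDist_lt_iff ⟨p, hp⟩).1 hx0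
    have hmono : ‖T (x t) - T q‖ ≤ ‖T (x 0) - T q‖ :=
      hF.antitoneOn_norm_sub hx (isSolution_const hq) Set.self_mem_Ici ht ht
    rw [← map_sub, ← map_sub] at hmono
    rw [dist_eq_norm, lt_div_iff₀' (by positivity)] at hq0
    calc Metric.infDist (x t) (equilibria F) ≤ dist (x t) q := Metric.infDist_le_dist_of_mem hq
      _ = ‖x t - q‖ := dist_eq_norm _ _
      _ ≤ c * ‖T (x t - q)‖ := h1 _
      _ ≤ c * ‖T (x 0 - q)‖ := by gcongr
      _ ≤ c * (C * ‖x 0 - q‖) := by gcongr; exact h2 _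
      _ = (c * C) * ‖x 0 - q‖ := by ring
      _ < ε := hq0
  attractive := by
    intro x hx
    obtain ⟨q, hq, hlim⟩ := hconv x hx
    exact squeeze_zero (fun _ => Metric.infDist_nonneg)
      (fun _ => Metric.infDist_le_dist_of_mem hq) (tendsto_iff_dist_tendsto_zero.1 hlim)

end Dissipative

/-! ### Gradients of convex functions -/

section Convex

variable {V : Type*} [NormedAddCommGroup V] [InnerProductSpace ℝ V] [CompleteSpace V] {g : V → ℝ}

lemma inner_gradient_eq_fderiv (g : V → ℝ) (x v : V) :
    inner ℝ (gradient g x) v = fderiv ℝ g x v := by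
  rw [gradient, InnerProductSpace.toDual_symm_apply]

lemma contDiff_one_gradient (hg : ContDiff ℝ 2 g) : ContDiff ℝ 1 (gradient g) :=
  (InnerProductSpace.toDual ℝ V).symm.contDiff.comp (hg.fderiv_right (by norm_num))

/-- A convex function lies above its tangent hyperplanes. -/
theorem add_inner_gradient_le (hg : ConvexOn ℝ Set.univ g) (hd : Differentiable ℝ g) (x y : V) :
    g x + inner ℝ (gradient g x) (y - x) ≤ g y := by
  have hconv : ConvexOn ℝ Set.univ (g ∘ AffineMap.lineMap (k := ℝ) x y) := hg.comp_affineMap _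
  have hder : HasDerivAt (g ∘ AffineMap.lineMap (k := ℝ) x y) (fderiv ℝ g x (y - x)) 0 := by
    have h1 : HasDerivAt (AffineMap.lineMap (k := ℝ) x y) (y - x) 0 := AffineMap.hasDerivAt_lineMap
    have h2 : HasFDerivAt g (fderiv ℝ g x) (AffineMap.lineMap (k := ℝ) x y 0) := by
      simpa using (hd x).hasFDerivAt
    exact h2.comp_hasDerivAt 0 h1
  have h := hconv.le_slope_of_hasDerivAt (Set.mem_univ 0) (Set.mem_univ 1) one_pos hder
  simp only [slope_def_field, Function.comp_apply, AffineMap.lineMap_apply_zero,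
    AffineMap.lineMap_apply_one, sub_zero, div_one] at h
  rw [inner_gradient_eq_fderiv]
  linarith

theorem inner_gradient_sub_nonneg (hg : ConvexOn ℝ Set.univ g) (hd : Differentiable ℝ g) (x y : V) :
    0 ≤ inner ℝ (gradient g x - gradient g y) (x - y) := by
  have h1 := add_inner_gradient_le hg hd x y
  have h2 := add_inner_gradient_le hg hd y x
  rw [← neg_sub x y, inner_neg_right] at h1
  rw [inner_sub_left]
  linarith

end Convex

/-! ### The aggregate cost -/

section Cost

variable {n N : ℕ} {f : Fin N → EuclideanSpace ℝ (Fin n) → ℝ}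

/-- `agentState` as a linear map of the aggregate state. -/
noncomputable def agentStateL (n : ℕ) {N : ℕ} (i : Fin N) :
    StateSpace n N →L[ℝ] EuclideanSpace ℝ (Fin n) :=
  LinearMap.toContinuousLinearMap
    { toFun := fun z => agentState z i
      map_add' := fun _ _ => rfl
      map_smul' := fun _ _ => rfl }

@[simp] lemma agentStateL_apply (z : StateSpace n N) (i : Fin N) :
    agentStateL n i z = agentState z i := rfl

/-- The consensus state `𝟏 ⊗ x`, in which every agent holds the vector `x`. -/
noncomputable def consensus (n N : ℕ) : EuclideanSpace ℝ (Fin n) →L[ℝ] StateSpace n N :=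
  LinearMap.toContinuousLinearMap
    { toFun := fun x => WithLp.toLp 2 fun ji => x ji.1
      map_add' := fun _ _ => rfl
      map_smul' := fun _ _ => rfl }

@[simp] lemma consensus_apply (x : EuclideanSpace ℝ (Fin n)) (j : Fin n) (i : Fin N) :
    consensus n N x (j, i) = x j := rfl

@[simp] lemma agentState_consensus (x : EuclideanSpace ℝ (Fin n)) (i : Fin N) :
    agentState (consensus n N x) i = x := rfl

lemma aggregateCost_consensus (f : Fin N → EuclideanSpace ℝ (Fin n) → ℝ) :
    aggregateCost f ∘ consensus n N = fun x => ∑ i, f i x := rfl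

lemma contDiff_aggregateCost (hf : ∀ i, ContDiff ℝ 2 (f i)) : ContDiff ℝ 2 (aggregateCost f) :=
  ContDiff.sum fun i _ => (hf i).comp (agentStateL n i).contDiff

lemma convexOn_aggregateCost (hf : ∀ i, ConvexOn ℝ Set.univ (f i)) :
    ConvexOn ℝ Set.univ (aggregateCost f) := by
  refine ⟨convex_univ, fun x _ y _ a b ha hb hab => ?_⟩
  simp only [aggregateCost, Finset.smul_sum, ← Finset.sum_add_distrib]
  refine Finset.sum_le_sum fun i _ => ?_
  exact ((hf i).comp_linearMap (agentStateL n i).toLinearMap).2 trivial trivial ha hb hab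

/-- At the consensus state of a minimizer of `∑ᵢ fᵢ` the gradient of the aggregate cost is
orthogonal to all consensus states. -/
lemma inner_gradient_consensus_eq_zero (hf : ∀ i, ContDiff ℝ 2 (f i))
    {xs : EuclideanSpace ℝ (Fin n)} (hmin : IsMinOn (fun x => ∑ i, f i x) Set.univ xs)
    (c : EuclideanSpace ℝ (Fin n)) :
    inner ℝ (gradient (aggregateCost f) (consensus n N xs)) (consensus n N c) = 0 := by
  have hd : HasFDerivAt (aggregateCost f ∘ consensus n N)
      ((fderiv ℝ (aggregateCost f) (consensus n N xs)).comp (consensus n N)) xs :=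
    (((contDiff_aggregateCost hf).differentiable two_ne_zero) _).hasFDerivAt.comp xs
      (consensus n N).hasFDerivAt
  rw [aggregateCost_consensus] at hd
  have h0 := (hmin.isLocalMin Filter.univ_mem).hasFDerivAt_eq_zero hd
  rw [inner_gradient_eq_fderiv]
  exact DFunLike.congr_fun h0 c

/-- Strict convexity of `∑ᵢ fᵢ` makes the aggregate gradient strictly monotone, at its minimizer,
in the directions of consensus. -/
lemma eq_of_inner_gradient_consensus (hc : ∀ i, ConvexOn ℝ Set.univ (f i))
    (hf : ∀ i, ContDiff ℝ 2 (f i)) (hs : StrictConvexOn ℝ Set.univ (fun x => ∑ i, f i x))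
    {xs x : EuclideanSpace ℝ (Fin n)} (hmin : IsMinOn (fun x => ∑ i, f i x) Set.univ xs)
    (h : inner ℝ (gradient (aggregateCost f) (consensus n N x) -
        gradient (aggregateCost f) (consensus n N xs)) (consensus n N x - consensus n N xs) = 0) :
    x = xs := by
  have h0 := inner_gradient_consensus_eq_zero hf hmin (x - xs)
  rw [map_sub] at h0
  rw [inner_sub_left, h0, sub_zero] at h
  have h1 := add_inner_gradient_le (convexOn_aggregateCost hc)
    ((contDiff_aggregateCost hf).differentiable two_ne_zero) (consensus n N x) (consensus n N xs)
  rw [← neg_sub (consensus n N x), inner_neg_right, h, neg_zero, add_zero] at h1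
  have h2 : ∑ i, f i x ≤ ∑ i, f i xs := h1
  exact hs.eq_of_isMinOn (fun y hy => h2.trans (hmin hy)) hmin trivial trivial

end Cost

/-! ### Incidence matrices of connected graphs -/

section Incidence

variable {n N : ℕ} {G : SimpleGraph (Fin N)} (o : EdgeOrientation G)

lemma EdgeOrientation.adj (e : G.edgeSet) : G.Adj (o.tail e) (o.head e) := by
  rw [← SimpleGraph.mem_edgeSet, o.mk_eq]
  exact e.2

lemma toEuclideanLin_transpose_aggIncidence_apply (z : StateSpace n N) (j : Fin n)
    (e : G.edgeSet) : Matrix.toEuclideanLin (aggIncidence n o).transpose z (j, e) =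
      z (j, o.head e) - z (j, o.tail e) := by
  have hne : o.tail e ≠ o.head e := (o.adj e).ne
  have hinc : ∀ i, incidence o i e =
      (if i = o.head e then 1 else 0) - (if i = o.tail e then 1 else 0) := by
    intro i
    simp only [incidence, Matrix.of_apply]
    split_ifs with h1 h2 <;> simp
    exact hne (h2.symm.trans h1)
  simp only [Matrix.ofLp_toLpLin, Matrix.toLin'_apply, Matrix.mulVec, dotProduct, Matrix.transpose_apply,
    aggIncidence, Matrix.kroneckerMap_apply, Fintype.sum_prod_type, Matrix.one_apply, hinc]
  simp [sub_mul, Finset.sum_sub_distrib]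

lemma toEuclideanLin_transpose_aggIncidence_consensus (x : EuclideanSpace ℝ (Fin n)) :
    Matrix.toEuclideanLin (aggIncidence n o).transpose (consensus n N x) = 0 := by
  ext ⟨j, e⟩
  simp [toEuclideanLin_transpose_aggIncidence_apply]

/-- For a connected graph, the kernel of `𝐃ᵀ` consists of the consensus states. -/
theorem exists_consensus_of_transpose_aggIncidence_eq_zero (hG : G.Connected) {z : StateSpace n N}
    (hz : Matrix.toEuclideanLin (aggIncidence n o).transpose z = 0) :
    ∃ x, z = consensus n N x := by
  have hadj : ∀ {i k}, G.Adj i k → ∀ j, z (j, i) = z (j, k) := by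
    intro i k hik j
    have he := toEuclideanLin_transpose_aggIncidence_apply o z j ⟨s(i, k), hik⟩
    rw [hz] at he
    have he' : z (j, o.head ⟨s(i, k), hik⟩) = z (j, o.tail ⟨s(i, k), hik⟩) :=
      (sub_eq_zero.1 he.symm)
    rcases Sym2.eq_iff.1 (o.mk_eq ⟨s(i, k), hik⟩) with ⟨h1, h2⟩ | ⟨h1, h2⟩
    · rw [h1, h2] at he'
      exact he'.symm
    · rw [h1, h2] at he'
      exact he'
  have hwalk : ∀ {i k} (_ : G.Walk i k) (j), z (j, i) = z (j, k) := by
    intro i k w j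
    induction w with
    | nil => rfl
    | cons h _ ih => exact (hadj h j).trans ih
  obtain ⟨i₀⟩ := hG.nonempty
  refine ⟨agentState z i₀, ?_⟩
  ext ⟨j, i⟩
  obtain ⟨w⟩ := hG.preconnected i i₀
  exact hwalk w j

variable [DecidableRel G.Adj]

lemma aggLaplacian_eq : aggLaplacian n o = aggIncidence n o * (aggIncidence n o).transpose := by
  rw [aggLaplacian, aggIncidence, ← Matrix.kroneckerMap_transpose, ← Matrix.mul_kronecker_mul,
    Matrix.transpose_one, Matrix.one_mul, laplacian]

lemma toEuclideanLin_aggLaplacian (z : StateSpace n N) :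
    Matrix.toEuclideanLin (aggLaplacian n o) z = Matrix.toEuclideanLin (aggIncidence n o)
      (Matrix.toEuclideanLin (aggIncidence n o).transpose z) := by
  classical
  rw [aggLaplacian_eq]
  simp [Matrix.toLpLin_apply, Matrix.mulVec_mulVec]

lemma inner_toEuclideanLin_aggIncidence (μ : DualSpace n G) (z : StateSpace n N) :
    inner ℝ (Matrix.toEuclideanLin (aggIncidence n o) μ) z =
      inner ℝ μ (Matrix.toEuclideanLin (aggIncidence n o).transpose z) := by
  classical
  rw [← Matrix.conjTranspose_eq_transpose_of_trivial, Matrix.toEuclideanLin_conjTranspose_eq_adjoint,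
    LinearMap.adjoint_inner_right]

/-- For a connected graph, the vectors orthogonal to consensus are in the range of `𝐃`. -/
theorem exists_aggIncidence_eq_of_inner_consensus (hG : G.Connected) {g : StateSpace n N}
    (hg : ∀ c, inner ℝ g (consensus n N c) = 0) :
    ∃ μ : DualSpace n G, Matrix.toEuclideanLin (aggIncidence n o) μ = g := by
  change g ∈ LinearMap.range (Matrix.toEuclideanLin (aggIncidence n o))
  rw [← Submodule.orthogonal_orthogonal (LinearMap.range _), Submodule.mem_orthogonal']
  intro u hu
  rw [Submodule.mem_orthogonal] at hu
  have hu0 : Matrix.toEuclideanLin (aggIncidence n o).transpose u = 0 := by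
    rw [← inner_self_eq_zero (𝕜 := ℝ), ← inner_toEuclideanLin_aggIncidence]
    exact hu _ ⟨_, rfl⟩
  obtain ⟨c, rfl⟩ := exists_consensus_of_transpose_aggIncidence_eq_zero o hG hu0
  exact hg c

end Incidence

/-! ### The PI dynamics -/

section PI

variable {n N : ℕ} {f : Fin N → EuclideanSpace ℝ (Fin n) → ℝ} {G : SimpleGraph (Fin N)}
  [DecidableRel G.Adj] (o : EdgeOrientation G) {kG kP kI : ℝ}

/-- The identity map from the state space of the PI dynamics, which carries the supremum norm of a
product, to the Hilbert space with norm `‖(z, μ)‖² = ‖z‖² + ‖μ‖²`. -/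
noncomputable def toHilbert (n : ℕ) {N : ℕ} (G : SimpleGraph (Fin N)) [DecidableRel G.Adj] :
    (StateSpace n N × DualSpace n G) ≃L[ℝ] WithLp 2 (StateSpace n N × DualSpace n G) :=
  (WithLp.prodContinuousLinearEquiv 2 ℝ (StateSpace n N) (DualSpace n G)).symm

lemma inner_toHilbert (p q : StateSpace n N × DualSpace n G) :
    inner ℝ (toHilbert n G p) (toHilbert n G q) = inner ℝ p.1 q.1 + inner ℝ p.2 q.2 :=
  WithLp.prod_inner_apply _ _

/-- The rate at which two solutions of the PI dynamics approach each other: the couplings through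
`𝐃` and `𝐃ᵀ` cancel, which leaves the monotone gradient and the Laplacian. -/
theorem inner_piField_sub (f : Fin N → EuclideanSpace ℝ (Fin n) → ℝ) (kG kP kI : ℝ)
    (p q : StateSpace n N × DualSpace n G) :
    inner ℝ (toHilbert n G (piField f o kG kP kI p) - toHilbert n G (piField f o kG kP kI q))
        (toHilbert n G p - toHilbert n G q) =
      -(kG * inner ℝ (gradient (aggregateCost f) p.1 - gradient (aggregateCost f) q.1)
          (p.1 - q.1)) -
        kP * ‖Matrix.toEuclideanLin (aggIncidence n o).transpose (p.1 - q.1)‖ ^ 2 := by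
  rw [← map_sub, ← map_sub, inner_toHilbert, ← real_inner_self_eq_norm_sq,
    ← inner_toEuclideanLin_aggIncidence]
  have hI := inner_toEuclideanLin_aggIncidence o (p.2 - q.2) (p.1 - q.1)
  have h1 : (piField f o kG kP kI p - piField f o kG kP kI q).1 =
      -(kG • (gradient (aggregateCost f) p.1 - gradient (aggregateCost f) q.1)) -
        kP • Matrix.toEuclideanLin (aggIncidence n o)
          (Matrix.toEuclideanLin (aggIncidence n o).transpose (p.1 - q.1)) -
        kI • Matrix.toEuclideanLin (aggIncidence n o) (p.2 - q.2) := by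
    simp only [piField, Prod.fst_sub, toEuclideanLin_aggLaplacian, map_sub, smul_sub]
    abel
  have h2 : (piField f o kG kP kI p - piField f o kG kP kI q).2 =
      kI • Matrix.toEuclideanLin (aggIncidence n o).transpose (p.1 - q.1) := by
    simp only [piField, Prod.snd_sub, map_sub, smul_sub]
  rw [h1, h2, Prod.fst_sub, Prod.snd_sub, inner_sub_left, inner_sub_left, inner_neg_left,
    real_inner_smul_left, real_inner_smul_left, real_inner_smul_left, real_inner_smul_left, hI,
    real_inner_comm (p.2 - q.2)]
  ring

theorem dissipative_piField (hc : ∀ i, ConvexOn ℝ Set.univ (f i)) (hf : ∀ i, ContDiff ℝ 2 (f i))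
    (hkG : 0 < kG) (hkP : 0 < kP) : Dissipative (toHilbert n G) (piField f o kG kP kI) := by
  intro p q
  rw [inner_piField_sub]
  have h := inner_gradient_sub_nonneg (convexOn_aggregateCost hc)
    ((contDiff_aggregateCost hf).differentiable two_ne_zero) p.1 q.1
  have h1 := mul_nonneg hkG.le h
  have h2 := mul_nonneg hkP.le
    (sq_nonneg ‖Matrix.toEuclideanLin (aggIncidence n o).transpose (p.1 - q.1)‖)
  linarith

lemma contDiff_piField (hf : ∀ i, ContDiff ℝ 2 (f i)) :
    ContDiff ℝ 1 (piField f o kG kP kI) := by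
  have hlin : ∀ {V W : Type} [NormedAddCommGroup V] [NormedSpace ℝ V] [FiniteDimensional ℝ V]
      [NormedAddCommGroup W] [NormedSpace ℝ W] (A : V →ₗ[ℝ] W), ContDiff ℝ 1 A :=
    fun A => (LinearMap.toContinuousLinearMap A).contDiff
  have h1 := (contDiff_one_gradient (contDiff_aggregateCost hf)).comp
    (contDiff_fst (E := StateSpace n N) (F := DualSpace n G))
  refine ContDiff.prodMk ?_ ?_
  · exact ((h1.const_smul kG).neg.sub (((hlin _).comp contDiff_fst).const_smul kP)).sub
      (((hlin _).comp contDiff_snd).const_smul kI)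
  · exact ((hlin _).comp contDiff_fst).const_smul kI

/-- Over the consensus state of a minimizer of `∑ᵢ fᵢ` lies an equilibrium: the gradient there is
orthogonal to consensus, and hence balanced by `𝐃 μ` for some `μ`. -/
theorem exists_piField_eq_zero (hf : ∀ i, ContDiff ℝ 2 (f i)) (hG : G.Connected) (hkI : kI ≠ 0)
    {xs : EuclideanSpace ℝ (Fin n)} (hmin : IsMinOn (fun x => ∑ i, f i x) Set.univ xs) :
    ∃ μ : DualSpace n G, piField f o kG kP kI (consensus n N xs, μ) = 0 := by
  obtain ⟨μ, hμ⟩ := exists_aggIncidence_eq_of_inner_consensus o hG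
    (g := -((kG / kI) • gradient (aggregateCost f) (consensus n N xs))) fun c => by
      rw [inner_neg_left, real_inner_smul_left, inner_gradient_consensus_eq_zero hf hmin, mul_zero,
        neg_zero]
  refine ⟨μ, ?_⟩
  simp only [piField, toEuclideanLin_aggLaplacian,
    toEuclideanLin_transpose_aggIncidence_consensus, hμ, map_zero, smul_zero, sub_zero, smul_neg,
    smul_smul, mul_div_cancel₀ kG hkI, sub_neg_eq_add, neg_add_cancel, Prod.mk_zero_zero]

/-- The distance to an equilibrium over the minimizer `xs` is stationary only at points with
`z = 𝟏 ⊗ xs`. -/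
theorem fst_eq_consensus_of_inner_eq_zero (hc : ∀ i, ConvexOn ℝ Set.univ (f i))
    (hf : ∀ i, ContDiff ℝ 2 (f i)) (hs : StrictConvexOn ℝ Set.univ (fun x => ∑ i, f i x))
    (hG : G.Connected) (hkG : 0 < kG) (hkP : 0 < kP) {xs : EuclideanSpace ℝ (Fin n)}
    (hmin : IsMinOn (fun x => ∑ i, f i x) Set.univ xs) {μ : DualSpace n G}
    (hμ : piField f o kG kP kI (consensus n N xs, μ) = 0) {p : StateSpace n N × DualSpace n G}
    (hp : inner ℝ (toHilbert n G (piField f o kG kP kI p))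
      (toHilbert n G p - toHilbert n G (consensus n N xs, μ)) = 0) :
    p.1 = consensus n N xs := by
  have h := inner_piField_sub o f kG kP kI p (consensus n N xs, μ)
  rw [hμ, map_zero, sub_zero, hp] at h
  have h0 := inner_gradient_sub_nonneg (convexOn_aggregateCost hc)
    ((contDiff_aggregateCost hf).differentiable two_ne_zero) p.1 (consensus n N xs)
  have h1 := mul_nonneg hkG.le h0
  have h2 := mul_nonneg hkP.le
    (sq_nonneg ‖Matrix.toEuclideanLin (aggIncidence n o).transpose (p.1 - consensus n N xs)‖)
  have h3 : Matrix.toEuclideanLin (aggIncidence n o).transpose (p.1 - consensus n N xs) = 0 := by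
    have h4 := (mul_eq_zero.1 (le_antisymm (by linarith) h2)).resolve_left hkP.ne'
    exact norm_eq_zero.1 (pow_eq_zero_iff two_ne_zero |>.1 h4)
  rw [map_sub, toEuclideanLin_transpose_aggIncidence_consensus, sub_zero] at h3
  obtain ⟨x, hx⟩ := exists_consensus_of_transpose_aggIncidence_eq_zero o hG h3
  have h5 := (mul_eq_zero.1 (le_antisymm (by linarith) h1)).resolve_left hkG.ne'
  rw [hx] at h5 ⊢
  rw [eq_of_inner_gradient_consensus hc hf hs hmin h5]

/-- Solutions of the PI dynamics along which the distance to an equilibrium over the minimizer is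
stationary start at an equilibrium. -/
theorem piField_eq_zero_of_stationary (hc : ∀ i, ConvexOn ℝ Set.univ (f i))
    (hf : ∀ i, ContDiff ℝ 2 (f i)) (hs : StrictConvexOn ℝ Set.univ (fun x => ∑ i, f i x))
    (hG : G.Connected) (hkG : 0 < kG) (hkP : 0 < kP) {xs : EuclideanSpace ℝ (Fin n)}
    (hmin : IsMinOn (fun x => ∑ i, f i x) Set.univ xs) {μ : DualSpace n G}
    (hμ : piField f o kG kP kI (consensus n N xs, μ) = 0)
    {y : ℝ → StateSpace n N × DualSpace n G} (hy : IsSolution (piField f o kG kP kI) y)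
    (hst : ∀ t ≥ 0, inner ℝ (toHilbert n G (piField f o kG kP kI (y t)))
      (toHilbert n G (y t) - toHilbert n G (consensus n N xs, μ)) = 0) :
    piField f o kG kP kI (y 0) = 0 := by
  have hz : ∀ t ≥ 0, (y t).1 = consensus n N xs := fun t ht =>
    fst_eq_consensus_of_inner_eq_zero o hc hf hs hG hkG hkP hmin hμ (hst t ht)
  have h1 : HasDerivWithinAt (fun t => (y t).1) (piField f o kG kP kI (y 0)).1 (Set.Ici 0) 0 :=
    (hy 0 Set.self_mem_Ici).fst
  have h2 : HasDerivWithinAt (fun t => (y t).1) 0 (Set.Ici 0) 0 :=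
    (hasDerivWithinAt_const 0 _ (consensus n N xs)).congr hz (hz 0 le_rfl)
  refine Prod.ext ((uniqueDiffOn_Ici (0 : ℝ) 0 Set.self_mem_Ici).eq_deriv _ h1 h2) ?_
  simp only [piField, hz 0 le_rfl, toEuclideanLin_transpose_aggIncidence_consensus, smul_zero,
    Prod.snd_zero]

/-- All equilibria lie over the consensus state of the minimizer. -/
theorem fst_eq_consensus_of_piField_eq_zero (hc : ∀ i, ConvexOn ℝ Set.univ (f i))
    (hf : ∀ i, ContDiff ℝ 2 (f i)) (hs : StrictConvexOn ℝ Set.univ (fun x => ∑ i, f i x))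
    (hG : G.Connected) (hkG : 0 < kG) (hkP : 0 < kP) {xs : EuclideanSpace ℝ (Fin n)}
    (hmin : IsMinOn (fun x => ∑ i, f i x) Set.univ xs) {μ : DualSpace n G}
    (hμ : piField f o kG kP kI (consensus n N xs, μ) = 0) {p : StateSpace n N × DualSpace n G}
    (hp : piField f o kG kP kI p = 0) : p.1 = consensus n N xs :=
  fst_eq_consensus_of_inner_eq_zero o hc hf hs hG hkG hkP hmin hμ
    (by rw [hp, map_zero, inner_zero_left])

end PI

end PIOpt

theorem mainTheorem1 (n N : ℕ) (f : Fin N → EuclideanSpace ℝ (Fin n) → ℝ)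
    (hf_convex : ∀ i, ConvexOn ℝ Set.univ (f i))
    (hf_smooth : ∀ i, ContDiff ℝ 2 (f i))
    (hf_strict : StrictConvexOn ℝ Set.univ (fun x => ∑ i, f i x))
    (hf_min : ∃ xstar, IsMinOn (fun x => ∑ i, f i x) Set.univ xstar)
    (G : SimpleGraph (Fin N)) [DecidableRel G.Adj] (hG : G.Connected)
    (o : PIOpt.EdgeOrientation G)
    (kG kP kI : ℝ) (hkG : 0 < kG) (hkP : 0 < kP) (hkI : 0 < kI) :
    -- the velocity `(ż, μ̇) = (0, 0)` is globally asymptotically stable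
    PIOpt.GASVelocity (PIOpt.piField f o kG kP kI) ∧
    -- the set of points at which `(ż, μ̇) = (0, 0)` is globally asymptotically stable
    PIOpt.GASSet (PIOpt.piField f o kG kP kI)
      (PIOpt.equilibria (PIOpt.piField f o kG kP kI)) ∧
    -- every solution converges to one such point, and the agents reach consensus
    ∀ x : ℝ → PIOpt.StateSpace n N × PIOpt.DualSpace n G,
      PIOpt.IsSolution (PIOpt.piField f o kG kP kI) x →
      (∃ p ∈ PIOpt.equilibria (PIOpt.piField f o kG kP kI),
        Filter.Tendsto x Filter.atTop (𝓝 p)) ∧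
      ∃ c : EuclideanSpace ℝ (Fin n), ∀ i : Fin N,
        Filter.Tendsto (fun t => PIOpt.agentState (x t).1 i) Filter.atTop (𝓝 c) := by
  obtain ⟨xs, hmin⟩ := hf_min
  obtain ⟨μ, hμ⟩ := PIOpt.exists_piField_eq_zero (kG := kG) (kP := kP) o hf_smooth hG hkI.ne' hmin
  have hdiss := PIOpt.dissipative_piField (kI := kI) o hf_convex hf_smooth hkG hkP
  have hsmooth := PIOpt.contDiff_piField (kG := kG) (kP := kP) (kI := kI) o hf_smooth
  have hconv : ∀ x, PIOpt.IsSolution (PIOpt.piField f o kG kP kI) x →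
      ∃ q, PIOpt.piField f o kG kP kI q = 0 ∧ Filter.Tendsto x Filter.atTop (𝓝 q) := fun x hx =>
    hdiss.exists_tendsto hsmooth hμ (fun y hy => PIOpt.piField_eq_zero_of_stationary o hf_convex
      hf_smooth hf_strict hG hkG hkP hmin hμ hy) hx
  refine ⟨hdiss.gasVelocity hsmooth hμ hconv, hdiss.gasSet_equilibria hsmooth hμ hconv,
    fun x hx => ?_⟩
  obtain ⟨q, hq, hlim⟩ := hconv x hx
  refine ⟨⟨q, hq, hlim⟩, xs, fun i => ?_⟩
  have hq1 := PIOpt.fst_eq_consensus_of_piField_eq_zero o hf_convex hf_smooth hf_strict hG hkG hkP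
    hmin hμ hq
  have h := ((PIOpt.agentStateL n i).continuous.tendsto q.1).comp
    ((continuous_fst.tendsto q).comp hlim)
  simpa [Function.comp_def, hq1] using h
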